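/- Convex layers. For a finite set $S\subset\mathbb R^2$, take the convex hull of $S$, remove from $S$ all points lying on the boundary of this hull, and repeat with the remaining points until no point is left. If this takes exactly $t$ rounds, we say that $S$ has $t$ nested convex hulls (if all points of a nonempty $S$ are collinear, then $t=1$; for $S=\emptyset$, $t=0$). Angle-monotone graphs. A geometric graph spanning $S$ is a simple graph with vertex set $S$ whose edges are drawn as straight-line segments. A path $p_0,p_1,\dots,p_k$ in it is angle-monotone of width $90^\circ$ if there is a closed wedge of angle $90^\circ$ that contains all the edge vectors $p_{i+1}-p_i$. The graph is angle-monotone of width $90^\circ$ if every two of its vertices are connected by an angle-monotone path of width $90^\circ$. Statement. There is an absolute constant $C>0$ such that for every $t$ and every finite set $S$ of $n$ points in the plane with $t$ nested convex hulls there is an angle-monotone graph of width $90^\circ$ spanning $S$ with at most $C\,t^2\,n\log n$ edges (where for $n=0$ the bound is read as $0$). -/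

import Mathlib

/-- The Euclidean plane. -/
abbrev Plane : Type := EuclideanSpace ℝ (Fin 2)

/-- The directions of the closed wedge of angle `γ` (with `0 ≤ γ ≤ 2π`) whose bisector is spanned
by `u`: the vectors making an (unoriented) angle at most `γ / 2` with `u`. It is only used for
`u ≠ 0`, and only nonzero vectors (edges between distinct points) are tested for membership. -/
noncomputable def wedge (u : Plane) (γ : ℝ) : Set Plane :=
  {v | InnerProductGeometry.angle u v ≤ γ / 2}

/-- A geometric graph on a finite point set `S` is a simple graph with vertex set `S`, its edges
being drawn as straight segments. A path of it is angle-monotone of width `γ` if a single wedge of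
angle `γ` contains the vectors of all its edges, directed along the path. -/
def IsAngleMonotonePath {S : Finset Plane} {G : SimpleGraph S} {a b : S}
    (γ : ℝ) (p : G.Walk a b) : Prop :=
  p.IsPath ∧ ∃ u : Plane, u ≠ 0 ∧
    ∀ d ∈ p.darts, (d.snd : Plane) - (d.fst : Plane) ∈ wedge u γ

/-- A geometric graph is angle-monotone of width `γ` if any two vertices are connected by an
angle-monotone path of width `γ`. -/
def IsAngleMonotoneGraph {S : Finset Plane} (γ : ℝ) (G : SimpleGraph S) : Prop :=
  ∀ a b : S, ∃ p : G.Walk a b, IsAngleMonotonePath γ p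

open Classical in
/-- Removes from `S` the points on the boundary of its convex hull. (A point of `S` is in the hull,
so it is on the boundary exactly when it is not in the interior.) -/
noncomputable def peel (S : Finset Plane) : Finset Plane :=
  S.filter fun p => p ∉ frontier (convexHull ℝ (S : Set Plane))

/-- `S` has `t` nested convex hulls: repeatedly taking the convex hull of the remaining points and
removing the points on its boundary exhausts `S` after exactly `t` rounds. -/
def HasNestedConvexHulls (S : Finset Plane) (t : ℕ) : Prop :=
  peel^[t] S = ∅ ∧ ∀ i < t, (peel^[i] S).Nonempty

/-!
A point `p` removed from a layer has an outer normal there; folding its angle into `[0, π]` leaves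
an angle `φ p` and a sign. Of two points of one layer, neither lies beyond the other along the
other's normal. So if their signs agree and both normals lie in the fourth quadrant of some frame,
the points are comparable in the dominance order of that frame. Hence the points with `φ` in a given
quadrant split into at most `2 t` chains, one for each layer and sign.

A path that increases in a dominance order is angle-monotone of width `π / 2`. Joining each point of
a set to its successor and its predecessor in each of `k` chains costs `2 k` edges per point, and
then every point is connected by a monotone path to every chain element comparable with it.

Any two points are comparable in the frame at angle `β` or in the one at `β + π / 2`. If all angles
lie within `π / 2` of `β`, then the points with `φ ≤ β` are few chains for the first frame and those
with `β ≤ φ` are few chains for the second, so `8 t` edges per point connect the two sets. Recursion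
at a median angle takes `O(log n)` rounds.
-/

open Real Relation
open scoped RealInnerProductSpace

section IncreasingGraphs

variable {V κ : Type*}

/-- There is a walk from `x` to `y` in `G` all of whose steps go up in the order of `V`. -/
def IncreasingReachable [LE V] (G : SimpleGraph V) : V → V → Prop :=
  ReflTransGen fun a b => G.Adj a b ∧ a ≤ b

theorem IncreasingReachable.mono [LE V] {G H : SimpleGraph V} {x y : V} (hGH : G ≤ H)
    (h : IncreasingReachable G x y) : IncreasingReachable H x y :=
  ReflTransGen.mono (fun _ _ hab => ⟨hGH hab.1, hab.2⟩) _ _ h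

theorem exists_isLeast_of_isChain [Preorder V] {s : Set V} (hs : s.Finite) (hne : s.Nonempty)
    (hchain : IsChain (· ≤ ·) s) : ∃ a, IsLeast s a := by
  obtain ⟨a, ha⟩ := hs.exists_minimal hne
  exact ⟨a, ha.prop, fun _ hb => hchain.le_of_not_gt hb ha.prop (ha.not_lt hb)⟩

theorem ncard_edgeSet_fromEdgeSet_le {E : Set (Sym2 V)} (hE : E.Finite) :
    (SimpleGraph.fromEdgeSet E).edgeSet.ncard ≤ E.ncard := by
  rw [SimpleGraph.edgeSet_fromEdgeSet]
  exact Set.ncard_le_ncard Set.sdiff_subset hE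

theorem ncard_edgeSet_sup_le (G H : SimpleGraph V) :
    (G ⊔ H).edgeSet.ncard ≤ G.edgeSet.ncard + H.edgeSet.ncard := by
  rw [SimpleGraph.edgeSet_sup]
  exact Set.ncard_union_le _ _

variable [PartialOrder V] [Fintype κ]

theorem exists_graph_increasingReachable_of_le (X : Finset V) {C : κ → Set V}
    (hCX : ∀ c, C c ⊆ X) (hC : ∀ c, IsChain (· ≤ ·) (C c)) :
    ∃ G : SimpleGraph V, G.edgeSet.ncard ≤ X.card * Fintype.card κ ∧
      ∀ x ∈ X, ∀ c, ∀ z ∈ C c, x ≤ z → IncreasingReachable G x z := by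
  have exists_succ (c : κ) (x : V) :
      ∃ y, (C c ∩ Set.Ioi x).Nonempty → IsLeast (C c ∩ Set.Ioi x) y := by
    by_cases hne : (C c ∩ Set.Ioi x).Nonempty
    · have hfin : (C c ∩ Set.Ioi x).Finite :=
        (X.finite_toSet.subset (hCX c)).subset Set.inter_subset_left
      obtain ⟨y, hy⟩ := exists_isLeast_of_isChain hfin hne ((hC c).mono Set.inter_subset_left)
      exact ⟨y, fun _ => hy⟩
    · exact ⟨x, fun h => absurd h hne⟩
  choose succ hsucc using exists_succ
  -- Join each point to its successor in every chain.
  set E : Set (Sym2 V) := (fun a : V × κ => s(a.1, succ a.2 a.1)) '' (X ×ˢ Set.univ)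
  have hfin : ((X : Set V) ×ˢ (Set.univ : Set κ)).Finite := X.finite_toSet.prod Set.finite_univ
  refine ⟨SimpleGraph.fromEdgeSet E, ?_, fun x hx c z hz hxz => ?_⟩
  · calc (SimpleGraph.fromEdgeSet E).edgeSet.ncard
        ≤ E.ncard := ncard_edgeSet_fromEdgeSet_le (hfin.image _)
      _ ≤ ((X : Set V) ×ˢ (Set.univ : Set κ)).ncard := Set.ncard_image_le hfin
      _ = X.card * Fintype.card κ := by
        rw [Set.ncard_prod, Set.ncard_coe_finset, Set.ncard_univ, Nat.card_eq_fintype_card]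
  · revert hxz
    refine (X.finite_toSet.wellFoundedOn (r := (· > ·))).induction
      (P := fun x => x ≤ z → IncreasingReachable (SimpleGraph.fromEdgeSet E) x z) hx
      fun x hx ih hxz => ?_
    rcases hxz.eq_or_lt with rfl | hlt
    · exact ReflTransGen.refl
    · obtain ⟨⟨hyC, hxy⟩, hleast⟩ := hsucc c x ⟨z, hz, hlt⟩
      have hadj : (SimpleGraph.fromEdgeSet E).Adj x (succ c x) :=
        (SimpleGraph.fromEdgeSet_adj E).2 ⟨⟨(x, c), ⟨hx, trivial⟩, rfl⟩, ne_of_lt hxy⟩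
      exact (ih _ (hCX c hyC) hxy (hleast ⟨hz, hlt⟩)).head ⟨hadj, le_of_lt hxy⟩

theorem exists_graph_increasingReachable (X : Finset V) {C : κ → Set V}
    (hCX : ∀ c, C c ⊆ X) (hC : ∀ c, IsChain (· ≤ ·) (C c)) :
    ∃ G : SimpleGraph V, G.edgeSet.ncard ≤ 2 * (X.card * Fintype.card κ) ∧
      ∀ x ∈ X, ∀ c, ∀ z ∈ C c,
        (x ≤ z → IncreasingReachable G x z) ∧ (z ≤ x → IncreasingReachable G z x) := by
  obtain ⟨G, hGcard, hG⟩ := exists_graph_increasingReachable_of_le X hCX hC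
  obtain ⟨H, hHcard, hH⟩ : ∃ H : SimpleGraph V, H.edgeSet.ncard ≤ X.card * Fintype.card κ ∧
      ∀ x ∈ X, ∀ c, ∀ z ∈ C c, z ≤ x → ReflTransGen (fun a b => H.Adj a b ∧ b ≤ a) x z :=
    exists_graph_increasingReachable_of_le (V := Vᵒᵈ) X hCX fun c => (hC c).symm
  refine ⟨G ⊔ H, (ncard_edgeSet_sup_le G H).trans (by rw [two_mul]; exact add_le_add hGcard hHcard),
    fun x hx c z hz => ⟨fun hxz => (hG x hx c z hz hxz).mono le_sup_left, fun hzx => ?_⟩⟩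
  have hzx' : IncreasingReachable H z x :=
    ReflTransGen.mono (fun _ _ hab => ⟨hab.1.symm, hab.2⟩) _ _
      (ReflTransGen.swap _ _ (hH x hx c z hz hzx))
  exact hzx'.mono le_sup_right

end IncreasingGraphs

section Median

variable {V α : Type*} [LinearOrder α]

theorem card_filter_lt_add_card_filter_gt_le (X : Finset V) (f : V → α) (b : α) :
    Finset.card {x ∈ X | f x < b} + Finset.card {x ∈ X | b < f x} ≤ X.card := by
  rw [← Finset.card_filter_add_card_filter_not (s := X) (f · < b)]
  gcongr with x
  exact not_lt_of_gt

theorem exists_median {X : Finset V} (f : V → α) (hX : X.Nonempty) :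
    ∃ m ∈ X, 2 * Finset.card {x ∈ X | f x < f m} ≤ X.card ∧
      2 * Finset.card {x ∈ X | f m < f x} ≤ X.card := by
  set heavy : Finset V := {m ∈ X | X.card ≤ 2 * Finset.card {x ∈ X | f x ≤ f m}}
  have hne : heavy.Nonempty := by
    obtain ⟨m, hm, hmax⟩ := X.exists_max_image f hX
    refine ⟨m, Finset.mem_filter.2 ⟨hm, ?_⟩⟩
    rw [Finset.filter_true_of_mem hmax]
    omega
  obtain ⟨m, hm, hmin⟩ := heavy.exists_min_image f hne
  obtain ⟨hmX, hle⟩ := Finset.mem_filter.1 hm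
  refine ⟨m, hmX, ?_, ?_⟩
  · by_contra! hlt
    obtain ⟨y, hy, hmax⟩ := Finset.exists_max_image {x ∈ X | f x < f m} f
      (Finset.card_pos.1 (by omega))
    obtain ⟨hyX, hym⟩ := Finset.mem_filter.1 hy
    refine hym.not_ge (hmin y (Finset.mem_filter.2 ⟨hyX, hlt.le.trans ?_⟩))
    gcongr 2 * Finset.card ?_
    exact fun x hx => Finset.mem_filter.2 ⟨(Finset.mem_filter.1 hx).1, hmax x hx⟩
  · have hsum := Finset.card_filter_add_card_filter_not (s := X) (f · ≤ f m)
    simp only [not_le] at hsum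
    omega

end Median

section Linking

variable {S : Finset Plane} {G H : SimpleGraph S} {a b : S} {γ : ℝ}

/-- `a` and `b` are joined by an angle-monotone path of width `γ`. -/
def AngleMonotoneConn (γ : ℝ) (G : SimpleGraph S) (a b : S) : Prop :=
  ∃ p : G.Walk a b, IsAngleMonotonePath γ p

theorem AngleMonotoneConn.mono (hGH : G ≤ H) (h : AngleMonotoneConn γ G a b) :
    AngleMonotoneConn γ H a b := by
  obtain ⟨p, hp, u, hu, hwedge⟩ := h
  refine ⟨p.mapLe hGH, hp.mapLe hGH, u, hu, fun d hd => ?_⟩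
  rw [SimpleGraph.Walk.mapLe, SimpleGraph.Walk.darts_map, List.mem_map] at hd
  obtain ⟨e, he, rfl⟩ := hd
  exact hwedge e he

theorem AngleMonotoneConn.symm (h : AngleMonotoneConn γ G a b) : AngleMonotoneConn γ G b a := by
  obtain ⟨p, hp, u, hu, hwedge⟩ := h
  refine ⟨p.reverse, hp.reverse, -u, neg_ne_zero.2 hu, fun d hd => ?_⟩
  have hsymm := hwedge d.symm (SimpleGraph.Walk.mem_darts_reverse.1 hd)
  rw [wedge, Set.mem_ofPred_eq] at hsymm ⊢
  rwa [← neg_sub, InnerProductGeometry.angle_neg_neg]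

theorem exists_walk_of_reflTransGen {V : Type*} {G : SimpleGraph V} {r : V → V → Prop} {x y : V}
    (h : ReflTransGen (fun a b => G.Adj a b ∧ r a b) x y) :
    ∃ p : G.Walk x y, ∀ d ∈ p.darts, r d.fst d.snd := by
  induction h using ReflTransGen.head_induction_on with
  | refl => exact ⟨.nil, by simp⟩
  | head hab _ ih =>
    obtain ⟨p, hp⟩ := ih
    refine ⟨.cons hab.1 p, ?_⟩
    simpa only [SimpleGraph.Walk.darts_cons, List.forall_mem_cons] using ⟨hab.2, hp⟩

theorem angleMonotoneConn_of_reflTransGen {u : Plane} (hu : u ≠ 0)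
    (h : ReflTransGen (fun p q => G.Adj p q ∧ (q : Plane) - p ∈ wedge u γ) a b) :
    AngleMonotoneConn γ G a b := by
  classical
  obtain ⟨p, hp⟩ := exists_walk_of_reflTransGen (r := fun p q : S => (q : Plane) - p ∈ wedge u γ) h
  exact ⟨p.bypass, p.bypass_isPath, u, hu, fun d hd => hp d (p.darts_bypass_subset_darts hd)⟩

/-- All pairs in `A × B` can be joined by angle-monotone paths of width `γ` in a single graph with
at most `m` edges. -/
def Linkable (γ : ℝ) (m : ℕ) (A B : Finset S) : Prop :=
  ∃ G : SimpleGraph S, G.edgeSet.ncard ≤ m ∧ ∀ p ∈ A, ∀ q ∈ B, AngleMonotoneConn γ G p q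

theorem linkable_empty (γ : ℝ) (m : ℕ) (B : Finset S) : Linkable γ m ∅ B :=
  ⟨⊥, by simp, by simp⟩

theorem Linkable.of_pivot {φ : S → ℝ} {β : ℝ} {X : Finset S} {m₁ m₂ m : ℕ}
    (hlt : Linkable γ m₁ {p ∈ X | φ p < β} {p ∈ X | φ p < β})
    (hgt : Linkable γ m₂ {p ∈ X | β < φ p} {p ∈ X | β < φ p})
    (hsplit : Linkable γ m {p ∈ X | φ p ≤ β} {p ∈ X | β ≤ φ p}) :
    Linkable γ (m₁ + m₂ + m) X X := by
  obtain ⟨G₁, hcard₁, h₁⟩ := hlt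
  obtain ⟨G₂, hcard₂, h₂⟩ := hgt
  obtain ⟨H, hcard, h⟩ := hsplit
  simp only [Finset.mem_filter, and_imp] at h₁ h₂ h
  refine ⟨G₁ ⊔ G₂ ⊔ H, ?_, fun p hp q hq => ?_⟩
  · have := ncard_edgeSet_sup_le (G₁ ⊔ G₂) H
    have := ncard_edgeSet_sup_le G₁ G₂
    omega
  · rcases le_or_gt (φ p) β with hpβ | hpβ <;> rcases le_or_gt β (φ q) with hqβ | hqβ
    · exact (h p hp hpβ q hq hqβ).mono le_sup_right
    · rcases hpβ.eq_or_lt with hpβ | hpβ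
      · exact (h q hq hqβ.le p hp hpβ.ge).symm.mono le_sup_right
      · exact (h₁ p hp hpβ q hq hqβ).mono (le_sup_left.trans le_sup_left)
    · rcases hqβ.eq_or_lt with hqβ | hqβ
      · exact (h q hq hqβ.ge p hp hpβ.le).symm.mono le_sup_right
      · exact (h₂ p hp hpβ q hq hqβ).mono (le_sup_right.trans le_sup_left)
    · exact (h q hq hqβ.le p hp hpβ.le).symm.mono le_sup_right

end Linking

section Frames

/-- The unit vector at angle `θ` from the first coordinate axis. -/
noncomputable def unitVec (θ : ℝ) : Plane := !₂[cos θ, sin θ]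

theorem inner_unitVec (θ : ℝ) (v : Plane) : ⟪unitVec θ, v⟫ = cos θ * v 0 + sin θ * v 1 := by
  simp [unitVec, PiLp.inner_apply, Fin.sum_univ_two, mul_comm]

theorem norm_unitVec (θ : ℝ) : ‖unitVec θ‖ = 1 := by
  simp [unitVec, EuclideanSpace.norm_eq, Fin.sum_univ_two]

theorem unitVec_ne_zero (θ : ℝ) : unitVec θ ≠ 0 :=
  norm_ne_zero_iff.1 (by simp [norm_unitVec])

theorem unitVec_add (β θ : ℝ) :
    unitVec (β + θ) = cos θ • unitVec β + sin θ • unitVec (β + π / 2) := by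
  ext i
  fin_cases i <;> simp [unitVec, cos_add, sin_add] <;> ring

theorem unitVec_add_pi (β : ℝ) : unitVec (β + π) = -unitVec β := by
  simp [unitVec_add β π]

theorem inner_unitVec_add (β θ : ℝ) (v : Plane) :
    ⟪unitVec (β + θ), v⟫ = cos θ * ⟪unitVec β, v⟫ + sin θ * ⟪unitVec (β + π / 2), v⟫ := by
  rw [unitVec_add, inner_add_left, real_inner_smul_left, real_inner_smul_left]

theorem norm_sq_eq_inner_unitVec_sq_add (β : ℝ) (v : Plane) :
    ‖v‖ ^ 2 = ⟪unitVec β, v⟫ ^ 2 + ⟪unitVec (β + π / 2), v⟫ ^ 2 := by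
  simp only [inner_unitVec, cos_add_pi_div_two, sin_add_pi_div_two, EuclideanSpace.norm_sq_eq,
    Fin.sum_univ_two, norm_eq_abs, sq_abs]
  linear_combination (-(v 0) ^ 2 - (v 1) ^ 2) * sin_sq_add_cos_sq β

/-- The coordinates of a point in the orthonormal frame whose first axis has angle `β`. -/
noncomputable def frameCoords (β : ℝ) (p : Plane) : ℝ × ℝ :=
  (⟪unitVec β, p⟫, ⟪unitVec (β + π / 2), p⟫)

theorem frameCoords_injective (β : ℝ) : Function.Injective (frameCoords β) := by
  intro p q hpq
  obtain ⟨h₁, h₂⟩ := Prod.mk.inj hpq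
  rw [← sub_eq_zero, ← norm_eq_zero, ← sq_eq_zero_iff, norm_sq_eq_inner_unitVec_sq_add β,
    inner_sub_right, inner_sub_right, h₁, h₂]
  ring

/-- The dominance order in the frame whose first axis has angle `β`. -/
noncomputable abbrev frameOrder (β : ℝ) : PartialOrder Plane :=
  PartialOrder.lift (frameCoords β) (frameCoords_injective β)

/-- The relation `≤` of `frameOrder β`: as `β` varies, no single order can be an instance. -/
def FrameLE (β : ℝ) (p q : Plane) : Prop := frameCoords β p ≤ frameCoords β q

theorem frameLE_iff {β : ℝ} {p q : Plane} :
    FrameLE β p q ↔ 0 ≤ ⟪unitVec β, q - p⟫ ∧ 0 ≤ ⟪unitVec (β + π / 2), q - p⟫ := by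
  simp [FrameLE, frameCoords, inner_sub_right]

theorem FrameLE.sub_mem_wedge {β : ℝ} {p q : Plane} (h : FrameLE β p q) (hpq : p ≠ q) :
    q - p ∈ wedge (unitVec (β + π / 4)) (π / 2) := by
  obtain ⟨hx, hy⟩ := frameLE_iff.1 h
  have hpos : 0 < ‖q - p‖ := norm_pos_iff.2 (sub_ne_zero.2 hpq.symm)
  have hnorm : ‖q - p‖ ≤ ⟪unitVec β, q - p⟫ + ⟪unitVec (β + π / 2), q - p⟫ := by
    refine le_of_sq_le_sq ?_ (add_nonneg hx hy)
    rw [norm_sq_eq_inner_unitVec_sq_add β]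
    nlinarith [mul_nonneg hx hy]
  rw [wedge, Set.mem_ofPred_eq, show π / 2 / 2 = π / 4 by ring, InnerProductGeometry.angle,
    arccos_le_pi_div_four, norm_unitVec, one_mul, le_div_iff₀ hpos, inner_unitVec_add,
    cos_pi_div_four, sin_pi_div_four, ← mul_add]
  gcongr

theorem frameLE_or_frameLE_add_pi_div_two (β : ℝ) (p q : Plane) :
    (FrameLE β p q ∨ FrameLE β q p) ∨
      (FrameLE (β + π / 2) p q ∨ FrameLE (β + π / 2) q p) := by
  simp only [frameLE_iff, show β + π / 2 + π / 2 = β + π by ring, unitVec_add_pi, inner_neg_left,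
    inner_sub_right]
  grind

theorem inner_unitVec_neg_of_mem_Icc {β φ : ℝ} (hφ : φ ∈ Set.Icc (β - π / 2) β) {v : Plane}
    (hx : ⟪unitVec β, v⟫ < 0) (hy : 0 < ⟪unitVec (β + π / 2), v⟫) : ⟪unitVec φ, v⟫ < 0 := by
  obtain ⟨hβφ, hφβ⟩ := hφ
  have hcos : 0 ≤ cos (β - φ) := cos_nonneg_of_mem_Icc ⟨by linarith [pi_pos], by linarith⟩
  have hsin : 0 ≤ sin (β - φ) := sin_nonneg_of_nonneg_of_le_pi (by linarith) (by linarith [pi_pos])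
  have hv : ⟪unitVec φ, v⟫ =
      cos (β - φ) * ⟪unitVec β, v⟫ - sin (β - φ) * ⟪unitVec (β + π / 2), v⟫ := by
    have := inner_unitVec_add β (φ - β) v
    rw [add_sub_cancel, ← neg_sub β φ, cos_neg, sin_neg] at this
    linarith
  have hne : cos (β - φ) ≠ 0 ∨ sin (β - φ) ≠ 0 := by
    by_contra! h
    simpa [h.1, h.2] using sin_sq_add_cos_sq (β - φ)
  rw [hv]
  rcases hne with hne | hne
  · nlinarith [mul_nonneg hsin hy.le, mul_neg_of_pos_of_neg (hcos.lt_of_ne' hne) hx]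
  · nlinarith [mul_nonneg hcos (neg_nonneg.2 hx.le), mul_pos (hsin.lt_of_ne' hne) hy]

theorem frameLE_or_frameLE_of_inner_mul_inner_nonpos {β φ ψ : ℝ}
    (hφ : φ ∈ Set.Icc (β - π / 2) β) (hψ : ψ ∈ Set.Icc (β - π / 2) β) {p q : Plane}
    (h : ⟪unitVec φ, q - p⟫ * ⟪unitVec ψ, q - p⟫ ≤ 0) : FrameLE β p q ∨ FrameLE β q p := by
  have nonpos_of_neg {p q : Plane} (h : ⟪unitVec φ, q - p⟫ * ⟪unitVec ψ, q - p⟫ ≤ 0)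
      (hx : ⟪unitVec β, q - p⟫ < 0) : ⟪unitVec (β + π / 2), q - p⟫ ≤ 0 := by
    by_contra! hy
    exact h.not_gt (mul_pos_of_neg_of_neg (inner_unitVec_neg_of_mem_Icc hφ hx hy)
      (inner_unitVec_neg_of_mem_Icc hψ hx hy))
  have hneg (θ : ℝ) : ⟪unitVec θ, p - q⟫ = -⟪unitVec θ, q - p⟫ := by
    rw [← neg_sub, inner_neg_right]
  have hqp := nonpos_of_neg (p := q) (q := p) (by rwa [hneg, hneg, neg_mul_neg])
  rw [hneg, hneg, neg_lt_zero, neg_nonpos] at hqp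
  simp only [frameLE_iff, hneg, neg_nonneg]
  rcases lt_trichotomy ⟪unitVec β, q - p⟫ 0 with hx | hx | hx
  · exact .inr ⟨hx.le, nonpos_of_neg h hx⟩
  · exact (le_total 0 ⟪unitVec (β + π / 2), q - p⟫).imp (⟨hx.ge, ·⟩) (⟨hx.le, ·⟩)
  · exact .inl ⟨hx.le, hqp hx⟩

end Frames

section DivideAndConquer

variable {S : Finset Plane} {κ : Type*} [Fintype κ]

theorem exists_graph_of_frame_chains (β : ℝ) (X : Finset S) {C : κ → Set S} (hCX : ∀ c, C c ⊆ X)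
    (hC : ∀ c, IsChain (fun p q : S => FrameLE β p q) (C c)) :
    ∃ G : SimpleGraph S, G.edgeSet.ncard ≤ 2 * (X.card * Fintype.card κ) ∧
      ∀ p ∈ X, ∀ c, ∀ q ∈ C c, FrameLE β p q ∨ FrameLE β q p →
        AngleMonotoneConn (π / 2) G p q := by
  let := frameOrder β
  obtain ⟨G, hcard, hG⟩ := exists_graph_increasingReachable X hCX hC
  have conn {p q : S} (hpq : IncreasingReachable G p q) : AngleMonotoneConn (π / 2) G p q :=
    angleMonotoneConn_of_reflTransGen (unitVec_ne_zero (β + π / 4)) <|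
      ReflTransGen.mono (fun _ _ hab => ⟨hab.1, FrameLE.sub_mem_wedge hab.2
        (Subtype.coe_injective.ne hab.1.ne)⟩) _ _ hpq
  refine ⟨G, hcard, fun p hp c q hq h => ?_⟩
  rcases h with h | h
  · exact conn ((hG p hp c q hq).1 h)
  · exact (conn ((hG p hp c q hq).2 h)).symm

/-- The points of each colour whose angles `φ` lie in a common quadrant form a chain in the
dominance order of the frame that has this quadrant as its fourth one. -/
def IsChainLabelling (col : S → κ) (φ : S → ℝ) : Prop :=
  ∀ β c, IsChain (fun p q : S => FrameLE β p q) {p | col p = c ∧ φ p ∈ Set.Icc (β - π / 2) β}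

variable {col : S → κ} {φ : S → ℝ}

namespace IsChainLabelling

theorem exists_graph_of_mem_Icc (hφ : IsChainLabelling col φ) {β : ℝ} {X Y : Finset S}
    (hYX : Y ⊆ X) (hY : ∀ p ∈ Y, φ p ∈ Set.Icc (β - π / 2) β) :
    ∃ G : SimpleGraph S, G.edgeSet.ncard ≤ 2 * (X.card * Fintype.card κ) ∧
      ∀ p ∈ X, ∀ q ∈ Y, FrameLE β p q ∨ FrameLE β q p → AngleMonotoneConn (π / 2) G p q := by
  let C (c : κ) : Set S := {p | p ∈ Y ∧ col p = c}
  have hCsub (c : κ) : C c ⊆ {p | col p = c ∧ φ p ∈ Set.Icc (β - π / 2) β} :=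
    fun p hp => ⟨hp.2, hY p hp.1⟩
  obtain ⟨G, hcard, hG⟩ := exists_graph_of_frame_chains β X
    (fun c p (hp : p ∈ C c) => hYX hp.1) fun c => (hφ β c).mono (hCsub c)
  exact ⟨G, hcard, fun p hp q hq => hG p hp (col q) q ⟨hq, rfl⟩⟩

/-- Every pair is comparable in the frame at `β`, where the first set is a union of few chains, or
in the frame at `β + π / 2`, where the second one is. -/
theorem linkable_filter (hφ : IsChainLabelling col φ) {β : ℝ} {X : Finset S}
    (hX : ∀ p ∈ X, φ p ∈ Set.Icc (β - π / 2) (β + π / 2)) :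
    Linkable (π / 2) (4 * Fintype.card κ * X.card) {p ∈ X | φ p ≤ β} {p ∈ X | β ≤ φ p} := by
  obtain ⟨G, hGcard, hG⟩ := hφ.exists_graph_of_mem_Icc (X := X) (Y := {p ∈ X | φ p ≤ β}) (β := β)
    (Finset.filter_subset _ _) fun p hp => by
      rw [Finset.mem_filter] at hp
      exact ⟨(hX p hp.1).1, hp.2⟩
  obtain ⟨H, hHcard, hH⟩ := hφ.exists_graph_of_mem_Icc (X := X) (Y := {p ∈ X | β ≤ φ p})
    (β := β + π / 2) (Finset.filter_subset _ _) fun p hp => by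
      rw [Finset.mem_filter] at hp
      exact ⟨by linarith [hp.2], (hX p hp.1).2⟩
  refine ⟨G ⊔ H, (ncard_edgeSet_sup_le G H).trans (by linarith), fun p hp q hq => ?_⟩
  rcases frameLE_or_frameLE_add_pi_div_two β p q with hpq | hpq
  · exact (hG q (Finset.mem_filter.1 hq).1 p hp hpq.symm).symm.mono le_sup_left
  · exact (hH p (Finset.mem_filter.1 hp).1 q hq hpq).mono le_sup_right

theorem linkable_of_pivot (hφ : IsChainLabelling col φ) {β : ℝ} {X : Finset S} {k : ℕ}
    (hX : ∀ p ∈ X, φ p ∈ Set.Icc (β - π / 2) (β + π / 2))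
    (hlt : Linkable (π / 2) (k * Finset.card {p ∈ X | φ p < β}) {p ∈ X | φ p < β}
      {p ∈ X | φ p < β})
    (hgt : Linkable (π / 2) (k * Finset.card {p ∈ X | β < φ p}) {p ∈ X | β < φ p}
      {p ∈ X | β < φ p}) :
    Linkable (π / 2) ((k + 4 * Fintype.card κ) * X.card) X X := by
  obtain ⟨G, hcard, hG⟩ := hlt.of_pivot hgt (hφ.linkable_filter hX)
  refine ⟨G, hcard.trans ?_, hG⟩
  have hdisj := card_filter_lt_add_card_filter_gt_le X φ β
  rw [← mul_add, add_mul]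
  gcongr

theorem linkable_of_card_lt_two_pow (hφ : IsChainLabelling col φ) {a : ℝ} {h : ℕ} {X : Finset S}
    (hcard : X.card < 2 ^ h) (hX : ∀ p ∈ X, φ p ∈ Set.Icc a (a + π / 2)) :
    Linkable (π / 2) (4 * Fintype.card κ * h * X.card) X X := by
  induction h generalizing X with
  | zero =>
    obtain rfl : X = ∅ := by simpa using hcard
    exact linkable_empty _ _ _
  | succ h ih =>
    rcases X.eq_empty_or_nonempty with rfl | hne
    · exact linkable_empty _ _ _
    obtain ⟨m, hm, hlt, hgt⟩ := exists_median φ hne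
    have hX' : ∀ p ∈ X, φ p ∈ Set.Icc (φ m - π / 2) (φ m + π / 2) := fun p hp =>
      ⟨by linarith [(hX m hm).2, (hX p hp).1], by linarith [(hX m hm).1, (hX p hp).2]⟩
    rw [pow_succ] at hcard
    rw [mul_add_one]
    exact hφ.linkable_of_pivot hX'
      (ih (by omega) fun p hp => hX p (Finset.mem_filter.1 hp).1)
      (ih (by omega) fun p hp => hX p (Finset.mem_filter.1 hp).1)

theorem exists_isAngleMonotoneGraph (hφ : IsChainLabelling col φ) {h : ℕ} (hS : S.card < 2 ^ h)
    (hpi : ∀ p, φ p ∈ Set.Icc 0 π) :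
    ∃ G : SimpleGraph S, IsAngleMonotoneGraph (π / 2) G ∧
      G.edgeSet.ncard ≤ 4 * Fintype.card κ * (h + 1) * S.card := by
  have hcard (P : S → Prop) [DecidablePred P] : Finset.card {p | P p} < 2 ^ h :=
    (Finset.card_filter_le _ _).trans_lt (by simpa using hS)
  have hlt := hφ.linkable_of_card_lt_two_pow (a := 0) (hcard (φ · < π / 2)) fun p hp =>
    ⟨(hpi p).1, by simpa using (Finset.mem_filter.1 hp).2.le⟩
  have hgt := hφ.linkable_of_card_lt_two_pow (a := π / 2) (hcard (π / 2 < φ ·)) fun p hp =>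
    ⟨(Finset.mem_filter.1 hp).2.le, by simpa using (hpi p).2⟩
  obtain ⟨G, hGcard, hG⟩ := hφ.linkable_of_pivot (X := Finset.univ) (β := π / 2)
    (fun p _ => by simpa using hpi p) hlt hgt
  refine ⟨G, fun p q => hG p (Finset.mem_univ p) q (Finset.mem_univ q), ?_⟩
  simpa [mul_add] using hGcard

end IsChainLabelling

end DivideAndConquer

section Layers

theorem exists_forall_le_of_notMem_interior {E : Type*} [NormedAddCommGroup E]
    [NormedSpace ℝ E] [FiniteDimensional ℝ E] {A : Set E} (hA : Convex ℝ A) {p : E} (hp : p ∈ A)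
    (hint : p ∉ interior A) : ∃ f : StrongDual ℝ E, f ≠ 0 ∧ ∀ x ∈ A, f x ≤ f p := by
  by_cases hne : (interior A).Nonempty
  · exact geometric_hahn_banach_of_nonempty_interior_point hA hint hne
  · rw [hA.interior_nonempty_iff_affineSpan_eq_top,
      ← AffineSubspace.direction_eq_top_iff_of_nonempty ((affineSpan_nonempty ℝ).2 ⟨p, hp⟩)] at hne
    obtain ⟨f, hf, hker⟩ := Submodule.exists_le_ker_of_lt_top _ (lt_top_iff_ne_top.2 hne)
    refine ⟨f.toContinuousLinearMap, by simpa using hf, fun x hx => le_of_eq ?_⟩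
    have hfx : f (x - p) = 0 := hker (AffineSubspace.vsub_mem_direction
      (subset_affineSpan ℝ _ hx) (subset_affineSpan ℝ _ hp))
    simpa [sub_eq_zero] using hfx

theorem exists_eq_smul_unitVec {v : Plane} (hv : v ≠ 0) (hv₁ : 0 ≤ v 1) :
    ∃ φ ∈ Set.Icc 0 π, ∃ c : ℝ, 0 < c ∧ v = c • unitVec φ := by
  have hz : (⟨v 0, v 1⟩ : ℂ) ≠ 0 := by
    contrapose! hv
    ext i
    fin_cases i
    exacts [congrArg Complex.re hv, congrArg Complex.im hv]
  refine ⟨Complex.arg ⟨v 0, v 1⟩, ⟨Complex.arg_nonneg_iff.2 hv₁, Complex.arg_le_pi _⟩, _,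
    norm_pos_iff.2 hz, ?_⟩
  ext i
  fin_cases i <;> simp [unitVec, Complex.norm_mul_cos_arg, Complex.norm_mul_sin_arg]

theorem exists_sign_smul_eq_smul_unitVec {v : Plane} (hv : v ≠ 0) :
    ∃ φ ∈ Set.Icc 0 π, ∃ ε : ℤˣ, ∃ c : ℝ, 0 < c ∧ v = c • ((ε : ℤ) : ℝ) • unitVec φ := by
  rcases le_total 0 (v 1) with h | h
  · obtain ⟨φ, hφ, c, hc, hv⟩ := exists_eq_smul_unitVec hv h
    exact ⟨φ, hφ, 1, c, hc, by simpa using hv⟩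
  · obtain ⟨φ, hφ, c, hc, hv⟩ := exists_eq_smul_unitVec (neg_ne_zero.2 hv) (by simpa using h)
    exact ⟨φ, hφ, -1, c, hc, by simpa using neg_eq_iff_eq_neg.1 hv⟩

theorem exists_outer_normal {Y : Finset Plane} {p : Plane} (hp : p ∈ Y) (hpeel : p ∉ peel Y) :
    ∃ φ ∈ Set.Icc 0 π, ∃ ε : ℤˣ, ∀ x ∈ Y, ((ε : ℤ) : ℝ) * ⟪unitVec φ, x - p⟫ ≤ 0 := by
  have hfrontier : p ∈ frontier (convexHull ℝ (Y : Set Plane)) := by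
    simpa [peel, hp] using hpeel
  obtain ⟨f, hf, hmax⟩ := exists_forall_le_of_notMem_interior (convex_convexHull ℝ (Y : Set Plane))
    (subset_convexHull ℝ _ hp) hfrontier.2
  set v : Plane := (InnerProductSpace.toDual ℝ Plane).symm f with hvf
  have hv : v ≠ 0 := by simpa [hvf] using hf
  obtain ⟨φ, hφ, ε, c, hc, hvc⟩ := exists_sign_smul_eq_smul_unitVec hv
  refine ⟨φ, hφ, ε, fun x hx => nonpos_of_mul_nonpos_right ?_ hc⟩
  calc c * (((ε : ℤ) : ℝ) * ⟪unitVec φ, x - p⟫) = ⟪v, x - p⟫ := by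
        rw [hvc, real_inner_smul_left, real_inner_smul_left]
    _ = f x - f p := by rw [hvf, InnerProductSpace.toDual_symm_apply, map_sub]
    _ ≤ 0 := sub_nonpos.2 (hmax x (subset_convexHull ℝ _ hx))

theorem exists_mem_iterate_peel_notMem {S : Finset Plane} {t : ℕ} (h : peel^[t] S = ∅) {p : Plane}
    (hp : p ∈ S) : ∃ i : Fin t, p ∈ peel^[i] S ∧ p ∉ peel^[i + 1] S := by
  by_contra! hstep
  have hmem : ∀ i ≤ t, p ∈ peel^[i] S := by
    intro i
    induction i with
    | zero => exact fun _ => hp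
    | succ i ih => exact fun hi => hstep ⟨i, hi⟩ (ih (by omega))
  simpa [h] using hmem t le_rfl

theorem exists_isChainLabelling {S : Finset Plane} {t : ℕ} (h : peel^[t] S = ∅) :
    ∃ (col : S → Fin t × ℤˣ) (φ : S → ℝ), IsChainLabelling col φ ∧ ∀ p, φ p ∈ Set.Icc 0 π := by
  choose layer hmem hpeel using fun p : S => exists_mem_iterate_peel_notMem h p.2
  simp only [Function.iterate_succ_apply'] at hpeel
  choose φ hφ ε hnormal using fun p => exists_outer_normal (hmem p) (hpeel p)
  refine ⟨fun p => (layer p, ε p), φ, fun β c p hp q hq _ => ?_, hφ⟩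
  obtain ⟨hlayer, hε⟩ := Prod.mk.inj (hp.1.trans hq.1.symm)
  have hq_le := hnormal p q (hlayer ▸ hmem q)
  have hp_le := hnormal q p (hlayer ▸ hmem p)
  rw [← neg_sub, inner_neg_right, mul_neg, neg_nonpos, ← hε] at hp_le
  have hε_sq : ((ε p : ℤ) : ℝ) * ((ε p : ℤ) : ℝ) = 1 := by
    exact_mod_cast Int.units_coe_mul_self (ε p)
  refine frameLE_or_frameLE_of_inner_mul_inner_nonpos hp.2 hq.2 ?_
  calc ⟪unitVec (φ p), (q : Plane) - p⟫ * ⟪unitVec (φ q), (q : Plane) - p⟫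
      = (((ε p : ℤ) : ℝ) * ⟪unitVec (φ p), (q : Plane) - p⟫) *
          (((ε p : ℤ) : ℝ) * ⟪unitVec (φ q), (q : Plane) - p⟫) := by
        rw [mul_mul_mul_comm, hε_sq, one_mul]
    _ ≤ 0 := mul_nonpos_of_nonpos_of_nonneg hq_le hp_le

end Layers

theorem natLog_two_add_two_le {n : ℕ} (hn : 2 ≤ n) :
    (Nat.log 2 n : ℝ) + 2 ≤ 3 * (log n / log 2) := by
  have hlog : (Nat.log 2 n : ℝ) ≤ log n / log 2 := Real.natLog_le_logb n 2
  have hone : 1 ≤ log n / log 2 := by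
    rw [one_le_div (log_pos one_lt_two)]
    exact log_le_log two_pos (by exact_mod_cast hn)
  linarith

theorem mainTheorem4_general {S : Finset Plane} {t : ℕ} (h : peel^[t] S = ∅) :
    ∃ G : SimpleGraph S, IsAngleMonotoneGraph (π / 2) G ∧
      (G.edgeSet.ncard : ℝ) ≤ 24 / log 2 * t * S.card * log S.card := by
  obtain ⟨col, φ, hφ, hpi⟩ := exists_isChainLabelling h
  obtain ⟨G, hG, hcard⟩ := hφ.exists_isAngleMonotoneGraph
    (Nat.lt_pow_succ_log_self one_lt_two S.card) hpi
  refine ⟨G, hG, ?_⟩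
  rcases lt_or_ge S.card 2 with hS | hS
  · have : Subsingleton S := Finset.card_le_one_iff_subsingleton_coe.1 (by omega)
    rw [Subsingleton.elim G ⊥, SimpleGraph.edgeSet_bot, Set.ncard_empty, Nat.cast_zero]
    positivity
  · calc (G.edgeSet.ncard : ℝ)
        ≤ 4 * Fintype.card (Fin t × ℤˣ) * (Nat.log 2 S.card + 1 + 1) * S.card := by
          exact_mod_cast hcard
      _ = 8 * t * (Nat.log 2 S.card + 2) * S.card := by
          rw [Fintype.card_prod, Fintype.card_fin, Fintype.card_units_int]
          push_cast
          ring
      _ ≤ 8 * t * (3 * (log S.card / log 2)) * S.card := by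
          gcongr
          exact natLog_two_add_two_le hS
      _ = 24 / log 2 * t * S.card * log S.card := by ring

theorem mainTheorem4 :
    ∃ C : ℝ, 0 < C ∧ ∀ (t : ℕ) (S : Finset Plane), HasNestedConvexHulls S t →
      ∃ G : SimpleGraph S, IsAngleMonotoneGraph (Real.pi / 2) G ∧
        (G.edgeSet.ncard : ℝ) ≤ C * (t : ℝ) ^ 2 * (S.card : ℝ) * Real.log (S.card : ℝ) := by
  refine ⟨24 / log 2, by positivity, fun t S hS => ?_⟩
  obtain ⟨G, hG, hcard⟩ := mainTheorem4_general hS.1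
  exact ⟨G, hG, hcard.trans (by gcongr; exact_mod_cast Nat.le_self_pow two_ne_zero t)⟩
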